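/- Let $n\ge 1$ and $V_0^n=\{x\in\mathbb{R}^n: x_1+\cdots+x_n=0\}$. An ordered set partition of $\{1,\dots,n\}$ is a sequence $(T_1,\dots,T_m)$ of nonempty, pairwise disjoint subsets (blocks) with union $\{1,\dots,n\}$. The plate labeled by it is the cone $$[T_1,\dots,T_m]=\Big\{x\in V_0^n:\ \sum_{i\in T_1\cup\cdots\cup T_j}x_i\ge 0\ \text{ for } j=1,\dots,m-1\Big\};$$ $[[T_1,\dots,T_m]]$ denotes its characteristic function, and $\operatorname{len}(\pi)=m$ the number of blocks of the plate $\pi=[T_1,\dots,T_m]$, whose characteristic function is also written $[\pi]$. Let $\hat{\mathcal{P}}^n$ be the complex linear span of the characteristic functions of all plates in $V_0^n$, and let $\mathcal{P}^n$ be the quotient of $\hat{\mathcal{P}}^n$ by the span of those linear combinations of characteristic functions of plates that vanish outside a set of Lebesgue measure zero in $V_0^n$. Let $1\le l\le k$ and let $(S_l,S_{l-1},\dots,S_1,S_{l+1},\dots,S_k)$ be an ordered set partition of $\{1,\dots,n\}$. Then in $\mathcal{P}^n$ $$[[S_l,S_{l-1},\dots,S_1,S_{l+1},\dots,S_k]]=\sum_{\pi}(-1)^{k-l-1-\operatorname{len}(\pi)}\,[\pi],$$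 where the sum is over all plates $\pi$ labeled by ordered set partitions $(T_1,\dots,T_m)$ of $\{1,\dots,n\}$ such that each $S_i$ is contained in a single block $T_{p_{(S_i)}}$ and $$p_{(S_l)}\ge p_{(S_{l-1})}\ge\cdots\ge p_{(S_1)}<p_{(S_{l+1})}<\cdots<p_{(S_k)}.$$ -/

import Mathlib

open MeasureTheory

noncomputable section

/-- The hyperplane `V₀ⁿ = {x ∈ ℝⁿ : x₁ + ⋯ + xₙ = 0}`. -/
def V0 (n : ℕ) : Submodule ℝ (Fin n → ℝ) where
  carrier := {x | ∑ i, x i = 0}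
  add_mem' := by
    intro x y hx hy
    simp only [Set.mem_setOf_eq, Pi.add_apply, Finset.sum_add_distrib] at *
    rw [hx, hy, add_zero]
  zero_mem' := by simp
  smul_mem' := by
    intro c x hx
    simp only [Set.mem_setOf_eq, Pi.smul_apply, smul_eq_mul, ← Finset.mul_sum] at *
    rw [hx, mul_zero]

/-- The sequence of blocks `(S₁, …, S_k)` is an ordered set partition: the blocks are nonempty,
pairwise disjoint, and their union is everything. -/
structure IsOrderedSetPartition {n k : ℕ} (S : Fin k → Finset (Fin n)) : Prop where
  nonempty : ∀ i, (S i).Nonempty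
  disjoint : ∀ i j, i ≠ j → Disjoint (S i) (S j)
  cover : ∀ a, ∃ i, a ∈ S i

/-- Ordered set partitions of an `n`-element set, with any number `len` of blocks. -/
structure OrderedSetPartition (n : ℕ) where
  /-- the number of blocks -/
  len : ℕ
  /-- the blocks, from left to right -/
  block : Fin len → Finset (Fin n)
  isOrderedSetPartition : IsOrderedSetPartition block

theorem IsOrderedSetPartition.card_le {n k : ℕ} {S : Fin k → Finset (Fin n)}
    (hS : IsOrderedSetPartition S) : k ≤ n := by
  choose f hf using hS.nonempty
  have hinj : Function.Injective f := by
    intro i j hij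
    by_contra hne
    exact Finset.disjoint_left.mp (hS.disjoint i j hne) (hf i) (hij ▸ hf j)
  simpa using Fintype.card_le_of_injective f hinj

instance OrderedSetPartition.instFinite (n : ℕ) : Finite (OrderedSetPartition n) := by
  let g : OrderedSetPartition n → Σ m : Fin (n + 1), (Fin m.val → Finset (Fin n)) :=
    fun P => ⟨⟨P.len, Nat.lt_succ_of_le P.isOrderedSetPartition.card_le⟩, P.block⟩
  refine Finite.of_injective g ?_
  rintro ⟨a, f, hf⟩ ⟨b, h, hh⟩ hab
  obtain ⟨h1, h2⟩ := Sigma.mk.inj hab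
  obtain rfl : a = b := congrArg Fin.val h1
  obtain rfl := eq_of_heq h2
  rfl

/-- The plate `[S₁, …, S_k] ⊆ V₀ⁿ`: the cone `x_{S₁ ∪ ⋯ ∪ S_j} ≥ 0` for `j = 1, …, k - 1`, where
`x_S` is the sum of the coordinates of `x` in `S` (the equation `x₁ + ⋯ + xₙ = 0` is part of
`x ∈ V₀ⁿ`).  Blocks are indexed from `0`, so `S₁ ∪ ⋯ ∪ S_j` is the union of the `S i` with
`i < j`. -/
def OrderedSetPartition.plate {n : ℕ} (P : OrderedSetPartition n) : Set (V0 n) :=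
  {x | ∀ j : ℕ, 1 ≤ j → j < P.len →
    0 ≤ ∑ a ∈ (Finset.univ.filter fun i : Fin P.len => i.val < j).biUnion P.block, x.val a}

/-- The characteristic function `[π]` of the plate labeled by `P`. -/
def OrderedSetPartition.charFun {n : ℕ} (P : OrderedSetPartition n) : V0 n → ℂ :=
  P.plate.indicator 1

/-- The space `P̂ⁿ`: the complex linear span of the characteristic functions of all plates. -/
abbrev PlateSpan (n : ℕ) : Submodule ℂ (V0 n → ℂ) :=
  Submodule.span ℂ (Set.range (OrderedSetPartition.charFun (n := n)))

/-- The characteristic function of a plate, as an element of `P̂ⁿ`. -/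
def OrderedSetPartition.toPlateSpan {n : ℕ} (P : OrderedSetPartition n) : PlateSpan n :=
  ⟨P.charFun, Submodule.subset_span ⟨P, rfl⟩⟩

/-- The span of those linear combinations of characteristic functions of plates that vanish
outside a set of Lebesgue (that is, Haar) measure zero in the vector space `V₀ⁿ`. -/
def negligibleSpan (n : ℕ) : Submodule ℂ (PlateSpan n) :=
  Submodule.span ℂ {f | ∃ N : Set (V0 n),
    (Measure.addHaar : Measure (V0 n)) N = 0 ∧ ∀ x, x ∉ N → f.val x = 0}

/-- The space `Pⁿ`: the quotient of `P̂ⁿ` in which the linear combinations supported on a set of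
measure zero are set to zero. -/
abbrev PlateQuotient (n : ℕ) : Type :=
  PlateSpan n ⧸ negligibleSpan n

/-- The class in `Pⁿ` of the characteristic function of a plate. -/
def OrderedSetPartition.toPlateQuotient {n : ℕ} (P : OrderedSetPartition n) : PlateQuotient n :=
  (negligibleSpan n).mkQ P.toPlateSpan

/-- The sequence `(S_l, S_{l-1}, …, S₁, S_{l+1}, …, S_k)` obtained from `(S₁, …, S_k)` by
reversing its first `l` entries.  Entries are indexed from `0`. -/
def reverseInitial {α : Type} {k : ℕ} (l : ℕ) (hlk : l ≤ k) (S : Fin k → α) : Fin k → α :=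
  fun i => if h : i.val < l then S ⟨l - 1 - i.val, by omega⟩ else S i

/-- The ordered set partition `π` satisfies the orientations
`p_(S_l) ≥ ⋯ ≥ p_(S₁) < p_(S_{l+1}) < ⋯ < p_(S_k)`: every `S_i` is contained in a single block of
`π`, with position `p_(S_i)`, and these positions satisfy the listed inequalities.  The sequence
`S` is indexed from `0`, so `S₁` is `S 0` and `S_{l+1}` is `S l`. -/
def SatisfiesOrientations {n k : ℕ} (l : ℕ) (S : Fin k → Finset (Fin n))
    (π : OrderedSetPartition n) : Prop :=
  ∃ p : Fin k → Fin π.len,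
    (∀ i, S i ⊆ π.block (p i)) ∧
    (∀ i j : Fin k, i.val + 1 = j.val → j.val < l → p j ≥ p i) ∧
    (∀ i j : Fin k, i.val = 0 → j.val = l → p i < p j) ∧
    (∀ i j : Fin k, i.val + 1 = j.val → l ≤ i.val → p i < p j)

/-- The (finite) set of ordered set partitions satisfying the orientations
`p_(S_l) ≥ ⋯ ≥ p_(S₁) < p_(S_{l+1}) < ⋯ < p_(S_k)`. -/
def orientedPartitions {n k : ℕ} (l : ℕ) (S : Fin k → Finset (Fin n)) :
    Finset (OrderedSetPartition n) :=
  (Set.toFinite {π : OrderedSetPartition n | SatisfiesOrientations l S π}).toFinset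

end

/-! The identity holds pointwise off a null set. An ordered set partition is determined by the flag
of its proper partial unions of blocks, and a point `x` lies in its plate exactly when every member
of the flag has nonnegative coordinate sum. A partition with `m` blocks has a flag with `m - 1`
members, so at `x` the right side is, up to the global sign `(-1)^(k-l)`, the signed count `flagSum`
of nonnegative flags obeying the orientations.

This count is evaluated by merging blocks, starting from `S_l` alone. Let `Z = S_{j+1} ∪ ⋯ ∪ S_l`
lie together, with `S_j` weakly before it. If `Z` has negative sum, toggling `B \ Z`, where `B` is
the smallest member containing `Z` (or the whole set), cancels everything
(`flagSum_eq_zero_of_neg`). If the sum is positive, toggling `B ∪ Z`, where `B` is the largest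
member disjoint from `Z` (or `∅`), cancels the flags with `S_j` strictly before `Z`
(`flagSum_eq_zero_of_pos`); what survives has `S_j` and `Z` together, and the merging continues
(`flagSum_mergedConditions_succ`). The signs tested on the way are the first `l - 1` inequalities of
the plate on the left.

Once `S_1, …, S_l` are all together, the strict conditions leave a single flag, of `k - l` members
(`mergedConditions_zero_iff`); its nonnegativity is the remaining set of inequalities, and its sign
cancels the global one. Sums equal to zero are avoided by discarding finitely many hyperplanes
(`measure_nongeneric`). -/

/-- Toggling a distinguished element is a sign-reversing involution. -/
theorem Finset.sum_neg_one_pow_card_eq_zero_of_toggle {β : Type*} [Fintype β]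
    [DecidableEq β]
    (P : Finset β → Prop) [DecidablePred P] (C : Finset β → β)
    (hins : ∀ c, P c → P (insert (C c) c) ∧ C (insert (C c) c) = C c)
    (hera : ∀ c, P c → P (c.erase (C c)) ∧ C (c.erase (C c)) = C c) :
    ∑ c with P c, (-1 : ℂ) ^ c.card = 0 := by
  refine Finset.sum_involution
    (fun c _ => if C c ∈ c then c.erase (C c) else insert (C c) c) ?_ ?_ ?_ ?_
  · intro c _
    by_cases h : C c ∈ c
    · simp only [h, if_true]
      rw [← Finset.card_erase_add_one h, pow_succ]
      ring
    · simp only [h, if_false]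
      rw [Finset.card_insert_of_notMem h, pow_succ]
      ring
  · intro c _ _ heq
    by_cases h : C c ∈ c
    · simp only [h, if_true] at heq
      exact Finset.notMem_erase (C c) c (heq.symm ▸ h)
    · simp only [h, if_false] at heq
      exact h (Finset.insert_eq_self.mp heq)
  · intro c hc
    simp only [Finset.mem_filter, Finset.mem_univ, true_and] at hc ⊢
    split_ifs
    · exact (hera c hc).1
    · exact (hins c hc).1
  · intro c hc
    simp only [Finset.mem_filter, Finset.mem_univ, true_and] at hc
    by_cases h : C c ∈ c
    · simp [h, (hera c hc).2, Finset.insert_erase h]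
    · simp [h, (hins c hc).2, Finset.erase_insert h]

theorem subset_iff_of_sdiff_eq {α : Type*} [DecidableEq α] {Z B C Y : Finset α} (h : C \ Z = B \ Z) (hY : Disjoint Y Z) :
    Y ⊆ C ↔ Y ⊆ B := by
  have key : ∀ a ∈ Y, (a ∈ C ↔ a ∈ B) := by
    intro a ha
    have h1 := Finset.ext_iff.mp h a
    have h2 := Finset.disjoint_left.mp hY ha
    simpa [h2] using h1
  exact ⟨fun H a ha => (key a ha).1 (H ha), fun H a ha => (key a ha).2 (H ha)⟩

theorem disjoint_iff_of_sdiff_eq {α : Type*} [DecidableEq α] {Z B C Y : Finset α} (h : C \ Z = B \ Z) (hY : Disjoint Y Z) :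
    Disjoint Y C ↔ Disjoint Y B := by
  have key : ∀ a ∈ Y, (a ∈ C ↔ a ∈ B) := by
    intro a ha
    have h1 := Finset.ext_iff.mp h a
    have h2 := Finset.disjoint_left.mp hY ha
    simpa [h2] using h1
  simp only [Finset.disjoint_left]
  exact ⟨fun H a ha => (key a ha).not.1 (H ha), fun H a ha => (key a ha).not.2 (H ha)⟩

/-! ### Flags of subsets and the two cancelling toggles -/

section Chains

variable {α : Type*} [Fintype α] [DecidableEq α]

/-- Every member of `c` contains `Z` or is disjoint from it. -/
def Unsplit (c : Finset (Finset α)) (Z : Finset α) : Prop :=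
  ∀ B ∈ c, Z ⊆ B ∨ Disjoint Z B

/-- Every member of `c` that contains `Z` contains `Y`. -/
def WeaklyBefore (c : Finset (Finset α)) (Y Z : Finset α) : Prop :=
  ∀ B ∈ c, Z ⊆ B → Y ⊆ B

/-- Some member of `c` contains `Y` and is disjoint from `Z`. -/
def StrictlyBefore (c : Finset (Finset α)) (Y Z : Finset α) : Prop :=
  ∃ B ∈ c, Y ⊆ B ∧ Disjoint Z B

/-- A chain of proper nonempty subsets. -/
structure IsFlag (c : Finset (Finset α)) : Prop where
  chain : ∀ A ∈ c, ∀ B ∈ c, A ⊆ B ∨ B ⊆ A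
  nonempty : ∀ B ∈ c, B.Nonempty
  ne_univ : ∀ B ∈ c, B ≠ Finset.univ

/-- A flag all of whose members have nonnegative coordinate sum. -/
def IsNonnegFlag (x : α → ℝ) (c : Finset (Finset α)) : Prop :=
  IsFlag c ∧ ∀ B ∈ c, 0 ≤ ∑ a ∈ B, x a

open scoped Classical in
/-- The signed number of nonnegative flags with the property `Q`. -/
noncomputable def flagSum (x : α → ℝ) (Q : Finset (Finset α) → Prop) : ℂ :=
  ∑ c with IsNonnegFlag x c ∧ Q c, (-1 : ℂ) ^ c.card

theorem flagSum_eq_zero_of_toggle {x : α → ℝ} {Q : Finset (Finset α) → Prop}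
    (C : Finset (Finset α) → Finset α)
    (hins : ∀ c, IsNonnegFlag x c ∧ Q c →
      (IsNonnegFlag x (insert (C c) c) ∧ Q (insert (C c) c)) ∧ C (insert (C c) c) = C c)
    (hera : ∀ c, IsNonnegFlag x c ∧ Q c →
      (IsNonnegFlag x (c.erase (C c)) ∧ Q (c.erase (C c))) ∧ C (c.erase (C c)) = C c) :
    flagSum x Q = 0 := by
  classical
  have := Finset.sum_neg_one_pow_card_eq_zero_of_toggle
    (fun c => IsNonnegFlag x c ∧ Q c) C hins hera
  rw [← this, flagSum]

/-- The property `Q` depends only on the traces of the members on the complement of `Z`. -/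
def IgnoresInside (Z : Finset α) (Q : Finset (Finset α) → Prop) : Prop :=
  ∀ c C, (∃ B, (B = ∅ ∨ B = Finset.univ ∨ B ∈ c) ∧ C \ Z = B \ Z) → (Q (insert C c) ↔ Q c)

theorem IgnoresInside.and {Z : Finset α} {Q R : Finset (Finset α) → Prop}
    (hQ : IgnoresInside Z Q) (hR : IgnoresInside Z R) : IgnoresInside Z fun c => Q c ∧ R c :=
  fun c C h => and_congr (hQ c C h) (hR c C h)

theorem IgnoresInside.all {Z : Finset α} {ι : Sort*} {Q : ι → Finset (Finset α) → Prop}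
    (hQ : ∀ i, IgnoresInside Z (Q i)) : IgnoresInside Z fun c => ∀ i, Q i c :=
  fun c C h => forall_congr' fun i => hQ i c C h

/-- A set `Y` disjoint from `Z` sees only traces off `Z`, so the new member imposes on `Y` what some
old member, `∅` or the whole set already imposes. The two trivial sets are the default values in the
toggles. -/
theorem ignoresInside_unsplit {Y Z : Finset α} (hY : Disjoint Y Z) :
    IgnoresInside Z fun c => Unsplit c Y := by
  rintro c C ⟨B, hB, h⟩
  simp only [Unsplit, Finset.forall_mem_insert, subset_iff_of_sdiff_eq h hY,
    disjoint_iff_of_sdiff_eq h hY, and_iff_right_iff_imp]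
  intro H
  rcases hB with rfl | rfl | hB
  · simp
  · simp
  · exact H B hB

theorem ignoresInside_weaklyBefore {Y Y' Z : Finset α} (hY : Disjoint Y Z) (hY' : Disjoint Y' Z)
    (hne : Y'.Nonempty) : IgnoresInside Z fun c => WeaklyBefore c Y Y' := by
  rintro c C ⟨B, hB, h⟩
  simp only [WeaklyBefore, Finset.forall_mem_insert, subset_iff_of_sdiff_eq h hY,
    subset_iff_of_sdiff_eq h hY', and_iff_right_iff_imp]
  intro H
  rcases hB with rfl | rfl | hB
  · simp [hne.ne_empty]
  · simp
  · exact H B hB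

theorem ignoresInside_strictlyBefore {Y Y' Z : Finset α} (hY : Disjoint Y Z)
    (hY' : Disjoint Y' Z) (hne : Y.Nonempty) (hne' : Y'.Nonempty) :
    IgnoresInside Z fun c => StrictlyBefore c Y Y' := by
  rintro c C ⟨B, hB, h⟩
  simp only [StrictlyBefore, Finset.exists_mem_insert, subset_iff_of_sdiff_eq h hY,
    disjoint_iff_of_sdiff_eq h hY', or_iff_right_iff_imp]
  rintro ⟨h1, h2⟩
  rcases hB with rfl | rfl | hB
  · simp [hne.ne_empty] at h1
  · obtain ⟨a, ha⟩ := hne'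
    exact absurd (Finset.mem_univ a) (Finset.disjoint_left.mp h2 ha)
  · exact ⟨B, hB, h1, h2⟩

theorem IsFlag.mono {α : Type*} [Fintype α] {c d : Finset (Finset α)} (hc : IsFlag c) (h : d ⊆ c) : IsFlag d :=
  ⟨fun A hA B hB => hc.chain A (h hA) B (h hB), fun B hB => hc.nonempty B (h hB),
    fun B hB => hc.ne_univ B (h hB)⟩

theorem IsNonnegFlag.mono {α : Type*} [Fintype α] {x : α → ℝ} {c d : Finset (Finset α)} (hc : IsNonnegFlag x c)
    (h : d ⊆ c) : IsNonnegFlag x d :=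
  ⟨hc.1.mono h, fun B hB => hc.2 B (h hB)⟩

theorem IsNonnegFlag.insert {x : α → ℝ} {c : Finset (Finset α)} (hc : IsNonnegFlag x c)
    {C : Finset α} (hC : C.Nonempty) (hC' : C ≠ Finset.univ) (hx : 0 ≤ ∑ a ∈ C, x a)
    (h : ∀ B ∈ c, B ⊆ C ∨ C ⊆ B) : IsNonnegFlag x (insert C c) := by
  refine ⟨⟨?_, ?_, ?_⟩, ?_⟩
  · simp only [Finset.forall_mem_insert]
    refine ⟨⟨Or.inl subset_rfl, fun B hB => (h B hB).symm⟩, fun A hA => ⟨h A hA, ?_⟩⟩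
    exact hc.1.chain A hA
  · simpa only [Finset.forall_mem_insert] using ⟨hC, hc.1.nonempty⟩
  · simpa only [Finset.forall_mem_insert] using ⟨hC', hc.1.ne_univ⟩
  · simpa only [Finset.forall_mem_insert] using ⟨hx, hc.2⟩

/-- The largest member of a flag disjoint from `Z`, or `∅`. -/
noncomputable def largestDisjoint (Z : Finset α) (c : Finset (Finset α)) : Finset α :=
  (c.filter (Disjoint Z)).sup id

/-- The smallest member of a flag containing `Z`, or the whole set. -/
noncomputable def smallestContaining (Z : Finset α) (c : Finset (Finset α)) : Finset α :=
  (c.filter (Z ⊆ ·)).inf id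

/-- In a chain the union of two members is one of them, so the supremum is attained unless no member
qualifies. -/
theorem largestDisjoint_mem {Z : Finset α} {c : Finset (Finset α)} (hc : IsFlag c) :
    largestDisjoint Z c = ∅ ∨
      largestDisjoint Z c ∈ c ∧ Disjoint Z (largestDisjoint Z c) := by
  refine Finset.sup_mem {B | B = ∅ ∨ B ∈ c ∧ Disjoint Z B} (Or.inl rfl) ?_ _ _
    fun B hB => Or.inr (Finset.mem_filter.mp hB)
  rintro A (rfl | hA) B (rfl | hB)
  · simp
  · simpa using Or.inr hB
  · simpa using Or.inr hA
  · rcases hc.chain A hA.1 B hB.1 with h | h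
    · simpa [Finset.union_eq_right.mpr h] using Or.inr hB
    · simpa [Finset.union_eq_left.mpr h] using Or.inr hA

theorem smallestContaining_mem {Z : Finset α} {c : Finset (Finset α)} (hc : IsFlag c) :
    smallestContaining Z c = Finset.univ ∨
      smallestContaining Z c ∈ c ∧ Z ⊆ smallestContaining Z c := by
  refine Finset.inf_mem {B | B = Finset.univ ∨ B ∈ c ∧ Z ⊆ B} (Or.inl rfl) ?_ _ _
    fun B hB => Or.inr (Finset.mem_filter.mp hB)
  rintro A (rfl | hA) B (rfl | hB)
  · simp
  · simpa using Or.inr hB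
  · simpa using Or.inr hA
  · rcases hc.chain A hA.1 B hB.1 with h | h
    · simpa [Finset.inter_eq_left.mpr h] using Or.inr hA
    · simpa [Finset.inter_eq_right.mpr h] using Or.inr hB

/-- If `Z` has positive sum, flags in which `Z` is unsplit cancel by toggling the union of `Z`
with the part that precedes it. -/
theorem flagSum_eq_zero_of_pos {x : α → ℝ} (hx : ∑ a, x a = 0) {Z : Finset α}
    (hZ : 0 < ∑ a ∈ Z, x a) {Q : Finset (Finset α) → Prop}
    (hQ : ∀ c B, B = ∅ ∨ B ∈ c → Disjoint Z B → (Q (insert (B ∪ Z) c) ↔ Q c)) :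
    flagSum x (fun c => Unsplit c Z ∧ Q c) = 0 := by
  have hne : Z.Nonempty := by
    rw [Finset.nonempty_iff_ne_empty]
    rintro rfl
    simp at hZ
  have hnd : ∀ B : Finset α, ¬ Disjoint Z (B ∪ Z) := fun B h =>
    hne.ne_empty (by simpa using h.mono_right Finset.subset_union_right)
  apply flagSum_eq_zero_of_toggle fun c => largestDisjoint Z c ∪ Z
  · rintro c ⟨hc, hu, hq⟩
    have hL := largestDisjoint_mem (Z := Z) hc.1
    have hLd : Disjoint Z (largestDisjoint Z c) := by
      rcases hL with h | h
      · simp [h]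
      · exact h.2
    have hL0 : 0 ≤ ∑ a ∈ largestDisjoint Z c, x a := by
      rcases hL with h | h
      · simp [h]
      · exact hc.2 _ h.1
    have hsum : 0 < ∑ a ∈ largestDisjoint Z c ∪ Z, x a := by
      rw [Finset.sum_union hLd.symm]
      linarith
    refine ⟨⟨hc.insert (hne.mono Finset.subset_union_right) ?_ hsum.le ?_, ?_, ?_⟩, ?_⟩
    -- The total is zero, while the toggled set has positive sum.
    · intro h
      rw [h, hx] at hsum
      exact lt_irrefl _ hsum
    · intro B hB
      rcases hu B hB with h | h
      · right
        refine Finset.union_subset ?_ h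
        rcases hL with hL | hL
        · simp [hL]
        · rcases hc.1.chain _ hL.1 _ hB with h' | h'
          · exact h'
          · exact absurd (hLd.mono_right (h.trans h')) (by simpa using hne.ne_empty)
      · left
        refine subset_trans ?_ Finset.subset_union_left
        exact Finset.le_sup (f := id) (Finset.mem_filter.mpr ⟨hB, h⟩)
    · simp only [Unsplit, Finset.forall_mem_insert]
      exact ⟨Or.inl Finset.subset_union_right, hu⟩
    · exact (hQ c _ (hL.imp_right And.left) hLd).2 hq
    -- The toggled set meets `Z`, so it never enters the family defining `largestDisjoint`; the
    -- toggle therefore keeps its own target.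
    · simp only [largestDisjoint, Finset.filter_insert, hnd, if_false]
  · rintro c ⟨hc, hu, hq⟩
    have hL := largestDisjoint_mem (Z := Z) hc.1
    have hLd : Disjoint Z (largestDisjoint Z c) := by
      rcases hL with h | h
      · simp [h]
      · exact h.2
    refine ⟨⟨hc.mono (Finset.erase_subset _ _), fun B hB => hu B (Finset.mem_of_mem_erase hB),
      ?_⟩, ?_⟩
    · by_cases h : largestDisjoint Z c ∪ Z ∈ c
      -- Erasure is handled as the reverse of an insertion into the erased flag, where the largest
      -- disjoint member is still present.
      · refine (hQ _ (largestDisjoint Z c) ?_ hLd).1 (by rwa [Finset.insert_erase h])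
        refine hL.imp_right fun hL => Finset.mem_erase.mpr ⟨fun h => hnd (largestDisjoint Z c) ?_, hL.1⟩
        rwa [← h]
      · rwa [Finset.erase_eq_of_notMem h]
    · simp only [largestDisjoint, Finset.filter_erase]
      rw [Finset.erase_eq_of_notMem]
      simp [hnd]

/-- If `Z` has negative sum, flags in which `Z` is unsplit cancel by toggling what precedes `Z`
together with the part that `Z` shares its block with. -/
theorem flagSum_eq_zero_of_neg {x : α → ℝ} (hx : ∑ a, x a = 0) {Z : Finset α}
    (hZ : ∑ a ∈ Z, x a < 0) {Q : Finset (Finset α) → Prop}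
    (hQ : ∀ c B, B = Finset.univ ∨ B ∈ c → Z ⊆ B → (Q (insert (B \ Z) c) ↔ Q c)) :
    flagSum x (fun c => Unsplit c Z ∧ Q c) = 0 := by
  have hne : Z.Nonempty := by
    rw [Finset.nonempty_iff_ne_empty]
    rintro rfl
    simp at hZ
  have hns : ∀ B : Finset α, ¬ Z ⊆ B \ Z := fun B h =>
    hne.ne_empty (by simpa using (Finset.disjoint_sdiff (s := Z) (t := B)).mono_right h)
  apply flagSum_eq_zero_of_toggle fun c => smallestContaining Z c \ Z
  · rintro c ⟨hc, hu, hq⟩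
    have hL := smallestContaining_mem (Z := Z) hc.1
    have hLd : Z ⊆ smallestContaining Z c := by
      rcases hL with h | h
      · simp [h]
      · exact h.2
    have hL0 : 0 ≤ ∑ a ∈ smallestContaining Z c, x a := by
      rcases hL with h | h
      · simp [h, hx]
      · exact hc.2 _ h.1
    have hsum : 0 < ∑ a ∈ smallestContaining Z c \ Z, x a := by
      rw [Finset.sum_sdiff_eq_sub hLd]
      linarith
    refine ⟨⟨hc.insert ?_ ?_ hsum.le ?_, ?_, ?_⟩, ?_⟩
    · rw [Finset.nonempty_iff_ne_empty]
      intro h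
      simp [h] at hsum
    · intro h
      exact hns (smallestContaining Z c) (h ▸ Finset.subset_univ Z)
    · intro B hB
      rcases hu B hB with h | h
      · right
        refine Finset.sdiff_subset.trans ?_
        exact Finset.inf_le (f := id) (Finset.mem_filter.mpr ⟨hB, h⟩)
      · left
        refine Finset.subset_sdiff.mpr ⟨?_, h.symm⟩
        rcases hL with hL | hL
        · simp [hL]
        · rcases hc.1.chain _ hL.1 _ hB with h' | h'
          · exact absurd (h.mono_right (hL.2.trans h')) (by simpa using hne.ne_empty)
          · exact h'
    · simp only [Unsplit, Finset.forall_mem_insert]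
      exact ⟨Or.inr Finset.disjoint_sdiff, hu⟩
    · exact (hQ c _ (hL.imp_right And.left) hLd).2 hq
    · simp only [smallestContaining, Finset.filter_insert, hns, if_false]
  · rintro c ⟨hc, hu, hq⟩
    have hL := smallestContaining_mem (Z := Z) hc.1
    have hLd : Z ⊆ smallestContaining Z c := by
      rcases hL with h | h
      · simp [h]
      · exact h.2
    refine ⟨⟨hc.mono (Finset.erase_subset _ _), fun B hB => hu B (Finset.mem_of_mem_erase hB),
      ?_⟩, ?_⟩
    · by_cases h : smallestContaining Z c \ Z ∈ c
      · refine (hQ _ (smallestContaining Z c) ?_ hLd).1 (by rwa [Finset.insert_erase h])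
        refine hL.imp_right fun hL =>
          Finset.mem_erase.mpr ⟨fun h => hns (smallestContaining Z c) ?_, hL.1⟩
        rwa [← h]
      · rwa [Finset.erase_eq_of_notMem h]
    · simp only [smallestContaining, Finset.filter_erase]
      rw [Finset.erase_eq_of_notMem]
      simp [hns]

end Chains

/-! ### Weak and strict precedence in signed flag counts -/

section FlagCalculus

variable {α : Type*} [Fintype α] [DecidableEq α]

theorem flagSum_congr {α : Type*} [Fintype α] {x : α → ℝ} {Q R : Finset (Finset α) → Prop}
    (h : ∀ c, IsNonnegFlag x c → (Q c ↔ R c)) : flagSum x Q = flagSum x R := by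
  classical
  unfold flagSum
  refine Finset.sum_congr ?_ fun _ _ => rfl
  ext c
  simpa using h c

theorem flagSum_or {x : α → ℝ} {Q R : Finset (Finset α) → Prop} (h : ∀ c, Q c → ¬ R c) :
    flagSum x (fun c => Q c ∨ R c) = flagSum x Q + flagSum x R := by
  classical
  unfold flagSum
  rw [← Finset.sum_union]
  · refine Finset.sum_congr ?_ fun _ _ => rfl
    ext c
    simp [and_or_left]
  · rw [Finset.disjoint_left]
    intro c hc hc'
    simp only [Finset.mem_filter, Finset.mem_univ, true_and] at hc hc'
    exact h c hc.2 hc'.2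

theorem Unsplit.mono {α : Type*} {c : Finset (Finset α)} {Y Z : Finset α} (h : Unsplit c Z)
    (hY : Y ⊆ Z) : Unsplit c Y :=
  fun B hB => (h B hB).imp hY.trans fun h => h.mono_left hY

theorem not_disjoint_of_subset {α : Type*} {Y B : Finset α} (hne : Y.Nonempty) (h : Y ⊆ B) :
    ¬ Disjoint Y B := fun hd => hne.ne_empty (by simpa using hd.mono_right h)

theorem StrictlyBefore.weaklyBefore {α : Type*} [Fintype α] {c : Finset (Finset α)} (hc : IsFlag c) {Y Z : Finset α}
    (hZ : Z.Nonempty) (h : StrictlyBefore c Y Z) : WeaklyBefore c Y Z := by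
  obtain ⟨A, hA, hY, hd⟩ := h
  intro B hB hZB
  rcases hc.chain A hA B hB with h | h
  · exact hY.trans h
  · exact absurd hd (not_disjoint_of_subset hZ (hZB.trans h))

theorem StrictlyBefore.not_unsplit_union {α : Type*} [DecidableEq α] {c : Finset (Finset α)} {Y Z : Finset α}
    (hY : Y.Nonempty) (hZ : Z.Nonempty) (h : StrictlyBefore c Y Z) : ¬ Unsplit c (Y ∪ Z) := by
  obtain ⟨B, hB, h1, h2⟩ := h
  intro hu
  rcases hu B hB with h | h
  · exact not_disjoint_of_subset hZ (Finset.subset_union_right.trans h) h2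
  · exact not_disjoint_of_subset hY h1 (h.mono_left Finset.subset_union_left)

theorem Unsplit.weaklyBefore_iff {α : Type*} {c : Finset (Finset α)} {X Y Z : Finset α} (h : Unsplit c Z)
    (hY : Y.Nonempty) (hYZ : Y ⊆ Z) : WeaklyBefore c X Z ↔ WeaklyBefore c X Y := by
  refine ⟨fun H B hB hYB => H B hB ?_, fun H B hB hZB => H B hB (hYZ.trans hZB)⟩
  exact (h B hB).resolve_right fun hd => not_disjoint_of_subset hY hYB (hd.mono_left hYZ)

/-- A member separating `Y` from `Z` would either violate weak precedence or witness strict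
precedence. -/
theorem Unsplit.union {α : Type*} [DecidableEq α] {c : Finset (Finset α)} {Y Z : Finset α} (hY : Unsplit c Y)
    (hZ : Unsplit c Z) (hw : WeaklyBefore c Y Z) (hs : ¬ StrictlyBefore c Y Z) :
    Unsplit c (Y ∪ Z) := by
  intro B hB
  rcases hZ B hB with h | h
  · exact Or.inl (Finset.union_subset (hw B hB h) h)
  · rcases hY B hB with h' | h'
    · exact absurd ⟨B, hB, h', h⟩ hs
    · exact Or.inr (Finset.disjoint_union_left.mpr ⟨h', h⟩)

theorem Unsplit.weaklyBefore_of_union {α : Type*} [DecidableEq α] {c : Finset (Finset α)} {Y Z : Finset α}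
    (hZ : Z.Nonempty) (h : Unsplit c (Y ∪ Z)) : WeaklyBefore c Y Z := by
  intro B hB hZB
  rcases h B hB with h | h
  · exact Finset.subset_union_left.trans h
  · exact absurd (h.mono_left Finset.subset_union_right) (not_disjoint_of_subset hZ hZB)

/-- With `Z` of negative sum, the contribution of `Y` weakly before `Z` vanishes. -/
theorem flagSum_weaklyBefore_of_neg {x : α → ℝ} (hx : ∑ a, x a = 0) {Y Z : Finset α}
    (hZ : ∑ a ∈ Z, x a < 0) {Q : Finset (Finset α) → Prop}
    (hQ : IgnoresInside Z Q) :
    flagSum x (fun c => Unsplit c Z ∧ WeaklyBefore c Y Z ∧ Q c) = 0 := by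
  have hne : Z.Nonempty := by
    rw [Finset.nonempty_iff_ne_empty]
    rintro rfl
    simp at hZ
  refine flagSum_eq_zero_of_neg hx hZ fun c B hB hZB => and_congr ?_ (hQ c _ ⟨B, Or.inr hB, ?_⟩)
  -- Weak precedence constrains only members containing `Z`, and the toggled set does not contain
  -- it.
  · have : ¬ Z ⊆ B \ Z := fun h => not_disjoint_of_subset hne h Finset.disjoint_sdiff
    simp [WeaklyBefore, this]
  · simp

/-- With `Z` of positive sum, the contribution of `Y` weakly before `Z` equals that of `Y` and `Z`
lying together. -/
theorem flagSum_weaklyBefore_of_pos {x : α → ℝ} (hx : ∑ a, x a = 0) {Y Z : Finset α}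
    (hZ : 0 < ∑ a ∈ Z, x a) (hY : Y.Nonempty) {Q : Finset (Finset α) → Prop}
    (hQ : IgnoresInside Z Q) (hQY : ∀ c, Q c → Unsplit c Y) :
    flagSum x (fun c => Unsplit c Z ∧ WeaklyBefore c Y Z ∧ Q c) =
      flagSum x (fun c => Unsplit c (Y ∪ Z) ∧ Q c) := by
  have hne : Z.Nonempty := by
    rw [Finset.nonempty_iff_ne_empty]
    rintro rfl
    simp at hZ
  have hzero : flagSum x (fun c => Unsplit c Z ∧ StrictlyBefore c Y Z ∧ Q c) = 0 := by
    refine flagSum_eq_zero_of_pos hx hZ fun c B hB hZB =>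
      and_congr ?_ (hQ c _ ⟨B, hB.imp_right Or.inr, ?_⟩)
    -- The toggled set meets `Z`, so it can neither create nor destroy a witness of strict
    -- precedence.
    · have : ¬ Disjoint Z (B ∪ Z) := not_disjoint_of_subset hne Finset.subset_union_right
      simp [StrictlyBefore, this]
    · simp [Finset.union_sdiff_distrib]
  rw [← zero_add (flagSum x fun c => Unsplit c (Y ∪ Z) ∧ Q c), ← hzero, ← flagSum_or]
  · refine flagSum_congr fun c hc => ⟨?_, ?_⟩
    · rintro ⟨h1, h2, h3⟩
      by_cases hs : StrictlyBefore c Y Z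
      · exact Or.inl ⟨h1, hs, h3⟩
      · exact Or.inr ⟨(hQY c h3).union h1 h2 hs, h3⟩
    · rintro (⟨h1, h2, h3⟩ | ⟨h1, h2⟩)
      · exact ⟨h1, h2.weaklyBefore hc.1 hne, h3⟩
      · exact ⟨h1.mono Finset.subset_union_right, h1.weaklyBefore_of_union hne, h2⟩
  · rintro c ⟨_, h1, _⟩ ⟨h2, _⟩
    exact h1.not_unsplit_union hY hne h2

end FlagCalculus

/-! ### Merging the blocks and the one surviving flag -/

section Blocks

variable {n k : ℕ} {S : Fin k → Finset (Fin n)}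

/-- The union of the blocks with positions in `[a, b)`. -/
def blockUnion (S : Fin k → Finset (Fin n)) (a b : ℕ) : Finset (Fin n) :=
  (Finset.univ.filter fun i : Fin k => a ≤ i.val ∧ i.val < b).biUnion S

theorem mem_blockUnion {a b : ℕ} {t : Fin n} :
    t ∈ blockUnion S a b ↔ ∃ i : Fin k, (a ≤ i.val ∧ i.val < b) ∧ t ∈ S i := by
  simp [blockUnion]

theorem subset_blockUnion {a b : ℕ} (i : Fin k) (ha : a ≤ i.val) (hb : i.val < b) :
    S i ⊆ blockUnion S a b := fun _ ht => mem_blockUnion.mpr ⟨i, ⟨ha, hb⟩, ht⟩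

theorem blockUnion_mono {a b b' : ℕ} (h : b ≤ b') : blockUnion S a b ⊆ blockUnion S a b' := by
  intro t ht
  obtain ⟨i, ⟨h1, h2⟩, h3⟩ := mem_blockUnion.mp ht
  exact mem_blockUnion.mpr ⟨i, ⟨h1, by omega⟩, h3⟩

theorem blockUnion_succ_right {a b : ℕ} (hab : a ≤ b) (hb : b < k) :
    blockUnion S a (b + 1) = blockUnion S a b ∪ S ⟨b, hb⟩ := by
  ext t
  simp only [Finset.mem_union, mem_blockUnion]
  constructor
  · rintro ⟨i, ⟨h1, h2⟩, h3⟩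
    rcases Nat.lt_succ_iff_lt_or_eq.mp h2 with h | h
    · exact Or.inl ⟨i, ⟨h1, h⟩, h3⟩
    · obtain rfl : i = ⟨b, hb⟩ := Fin.ext h
      exact Or.inr h3
  · rintro (⟨i, ⟨h1, h2⟩, h3⟩ | h)
    · exact ⟨i, ⟨h1, by omega⟩, h3⟩
    · exact ⟨⟨b, hb⟩, ⟨hab, by simp⟩, h⟩

theorem blockUnion_succ_left {a b : ℕ} (hab : a < b) (ha : a < k) :
    blockUnion S a b = S ⟨a, ha⟩ ∪ blockUnion S (a + 1) b := by
  ext t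
  simp only [Finset.mem_union, mem_blockUnion]
  constructor
  · rintro ⟨i, ⟨h1, h2⟩, h3⟩
    rcases Nat.eq_or_lt_of_le h1 with h | h
    · obtain rfl : i = ⟨a, ha⟩ := Fin.ext h.symm
      exact Or.inl h3
    · exact Or.inr ⟨i, ⟨h, h2⟩, h3⟩
  · rintro (h | ⟨i, ⟨h1, h2⟩, h3⟩)
    · exact ⟨⟨a, ha⟩, ⟨le_rfl, hab⟩, h⟩
    · exact ⟨i, ⟨by omega, h2⟩, h3⟩

theorem IsOrderedSetPartition.eq_of_mem (hS : IsOrderedSetPartition S) {i j : Fin k} {t : Fin n}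
    (hi : t ∈ S i) (hj : t ∈ S j) : i = j := by
  by_contra hne
  exact Finset.disjoint_left.mp (hS.disjoint i j hne) hi hj

theorem IsOrderedSetPartition.mem_blockUnion_iff (hS : IsOrderedSetPartition S) {a b : ℕ}
    {i : Fin k} {t : Fin n} (ht : t ∈ S i) : t ∈ blockUnion S a b ↔ a ≤ i.val ∧ i.val < b := by
  refine mem_blockUnion.trans ⟨?_, fun h => ⟨i, h, ht⟩⟩
  rintro ⟨j, hj, htj⟩
  rwa [hS.eq_of_mem ht htj]

theorem IsOrderedSetPartition.disjoint_blockUnion_iff (hS : IsOrderedSetPartition S) {a b : ℕ}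
    {i : Fin k} : Disjoint (S i) (blockUnion S a b) ↔ ¬ (a ≤ i.val ∧ i.val < b) := by
  constructor
  · intro h h'
    obtain ⟨t, ht⟩ := hS.nonempty i
    exact Finset.disjoint_left.mp h ht ((hS.mem_blockUnion_iff ht).mpr h')
  · intro h
    rw [Finset.disjoint_left]
    exact fun t ht ht' => h ((hS.mem_blockUnion_iff ht).mp ht')

theorem IsOrderedSetPartition.subset_blockUnion_iff (hS : IsOrderedSetPartition S) {a b : ℕ}
    {i : Fin k} : S i ⊆ blockUnion S a b ↔ (a ≤ i.val ∧ i.val < b) := by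
  refine ⟨fun h => ?_, fun h => subset_blockUnion i h.1 h.2⟩
  obtain ⟨t, ht⟩ := hS.nonempty i
  exact (hS.mem_blockUnion_iff ht).mp (h ht)

theorem IsOrderedSetPartition.nonempty_blockUnion (hS : IsOrderedSetPartition S) {a b : ℕ}
    (hab : a < b) (ha : a < k) : (blockUnion S a b).Nonempty :=
  (hS.nonempty ⟨a, ha⟩).mono (subset_blockUnion _ le_rfl hab)

theorem IsOrderedSetPartition.blockUnion_ne_univ (hS : IsOrderedSetPartition S) {a b : ℕ}
    (i : Fin k) (hi : ¬ (a ≤ i.val ∧ i.val < b)) : blockUnion S a b ≠ Finset.univ := by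
  intro h
  apply hi
  rw [← hS.subset_blockUnion_iff, h]
  exact Finset.subset_univ _

/-- The orientation conditions that do not involve the blocks with positions in `[j, l)`,
except through the block at position `0`. -/
def OutsideConditions (S : Fin k → Finset (Fin n)) (l j : ℕ) (c : Finset (Finset (Fin n))) :
    Prop :=
  (∀ i : Fin k, i.val < j ∨ l ≤ i.val → Unsplit c (S i)) ∧
  (∀ i i' : Fin k, i.val + 1 = i'.val → i'.val < j → WeaklyBefore c (S i) (S i')) ∧
  (∀ i i' : Fin k, i.val = 0 → i'.val = l → StrictlyBefore c (S i) (S i')) ∧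
  (∀ i i' : Fin k, i.val + 1 = i'.val → l ≤ i.val → StrictlyBefore c (S i) (S i'))

/-- The orientation conditions with the blocks at positions in `[j, l)` lying together. -/
def MergedConditions (S : Fin k → Finset (Fin n)) (l j : ℕ) (c : Finset (Finset (Fin n))) :
    Prop :=
  Unsplit c (blockUnion S j l) ∧
  (∀ i : Fin k, i.val + 1 = j → WeaklyBefore c (S i) (blockUnion S j l)) ∧
  OutsideConditions S l j c

theorem IgnoresInside.imp {α : Type*} [Fintype α] [DecidableEq α] {Z : Finset α} {p : Prop}
    {Q : Finset (Finset α) → Prop} (hQ : p → IgnoresInside Z Q) :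
    IgnoresInside Z fun c => p → Q c :=
  fun c C h => imp_congr_right fun hp => hQ hp c C h

/-- Every block mentioned is disjoint from the merged part. The bound `1 ≤ j` is what keeps the
block at position `0`, which is compared with the one at `l`, outside it. -/
theorem ignoresInside_outsideConditions (hS : IsOrderedSetPartition S) {l j : ℕ} (hj : 1 ≤ j) : IgnoresInside (blockUnion S j l) (OutsideConditions S l j) := by
  refine IgnoresInside.and ?_ (IgnoresInside.and ?_ (IgnoresInside.and ?_ ?_))
  · refine IgnoresInside.all fun i => IgnoresInside.imp fun h => ignoresInside_unsplit ?_
    rw [hS.disjoint_blockUnion_iff]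
    omega
  · refine IgnoresInside.all fun i => IgnoresInside.all fun i' => IgnoresInside.imp fun h =>
      IgnoresInside.imp fun h' => ignoresInside_weaklyBefore ?_ ?_ (hS.nonempty _)
    all_goals
      rw [hS.disjoint_blockUnion_iff]
      omega
  all_goals
    refine IgnoresInside.all fun i => IgnoresInside.all fun i' => IgnoresInside.imp fun h =>
      IgnoresInside.imp fun h' => ignoresInside_strictlyBefore ?_ ?_ (hS.nonempty _)
        (hS.nonempty _)
    all_goals
      rw [hS.disjoint_blockUnion_iff]
      omega

/-- Isolates the conditions on block `j`, the next one to be absorbed into the merged part. -/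
theorem outsideConditions_succ {l j : ℕ} (hj : j < k) (c : Finset (Finset (Fin n))) :
    OutsideConditions S l (j + 1) c ↔ Unsplit c (S ⟨j, hj⟩) ∧
      (∀ i : Fin k, i.val + 1 = j → WeaklyBefore c (S i) (S ⟨j, hj⟩)) ∧
      OutsideConditions S l j c := by
  constructor
  · rintro ⟨h1, h2, h3, h4⟩
    refine ⟨h1 _ (Or.inl (by simp)), fun i hi => h2 _ _ hi (by simp), fun i hi => h1 _ (by omega),
      fun i i' h h' => h2 _ _ h (by omega), h3, h4⟩
  · rintro ⟨h0, h0', h1, h2, h3, h4⟩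
    refine ⟨fun i hi => ?_, fun i i' h h' => ?_, h3, h4⟩
    · by_cases h : i.val = j
      · obtain rfl : i = ⟨j, hj⟩ := Fin.ext h
        exact h0
      · exact h1 i (by omega)
    · by_cases hh : i'.val = j
      · obtain rfl : i' = ⟨j, hj⟩ := Fin.ext hh
        exact h0' i h
      · exact h2 _ _ h (by omega)

/-- Merging one more block. -/
theorem flagSum_mergedConditions_succ (hS : IsOrderedSetPartition S) {x : Fin n → ℝ}
    (hx : ∑ a, x a = 0) {l j : ℕ} (hjl : j + 1 < l) (hlk : l ≤ k)
    (hne : ∑ a ∈ blockUnion S (j + 1) l, x a ≠ 0) :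
    flagSum x (MergedConditions S l (j + 1)) =
      if 0 ≤ ∑ a ∈ blockUnion S (j + 1) l, x a then flagSum x (MergedConditions S l j) else 0 := by
  have hjk : j < k := by omega
  have hign := ignoresInside_outsideConditions hS (l := l) (Nat.succ_pos j)
  have hZ : (blockUnion S (j + 1) l).Nonempty := hS.nonempty_blockUnion hjl (by omega)
  have h1 : flagSum x (MergedConditions S l (j + 1)) = flagSum x fun c =>
      Unsplit c (blockUnion S (j + 1) l) ∧
      WeaklyBefore c (S ⟨j, hjk⟩) (blockUnion S (j + 1) l) ∧ OutsideConditions S l (j + 1) c := by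
    refine flagSum_congr fun c _ => and_congr_right fun _ => and_congr_left fun _ => ?_
    refine ⟨fun h => h _ rfl, fun h i hi => ?_⟩
    obtain rfl : i = ⟨j, hjk⟩ := Fin.ext (by simpa using hi)
    exact h
  rw [h1]
  split_ifs with hpos
  · rw [flagSum_weaklyBefore_of_pos hx (lt_of_le_of_ne hpos hne.symm) (hS.nonempty _) hign
      fun c hc => ((outsideConditions_succ hjk c).mp hc).1]
    rw [← blockUnion_succ_left (by omega) hjk]
    refine flagSum_congr fun c _ => and_congr_right fun hu => ?_
    rw [outsideConditions_succ hjk]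
    -- Once block `j` is absorbed, its being unsplit is automatic, and preceding it weakly is the
    -- same as preceding the merged part.
    have hsub : S ⟨j, hjk⟩ ⊆ blockUnion S j l := subset_blockUnion _ le_rfl (by simp; omega)
    simp only [hu.mono hsub, true_and, hu.weaklyBefore_iff (hS.nonempty _) hsub]
  · exact flagSum_weaklyBefore_of_neg hx (not_le.mp hpos) hign

open scoped Classical in
theorem flagSum_mergedConditions (hS : IsOrderedSetPartition S) {x : Fin n → ℝ}
    (hx : ∑ a, x a = 0) {l : ℕ} (hlk : l ≤ k)
    (hne : ∀ j, 1 ≤ j → j < l → ∑ a ∈ blockUnion S j l, x a ≠ 0) (j : ℕ) (hjl : j < l) :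
    flagSum x (MergedConditions S l j) =
      if ∀ i, 1 ≤ i → i ≤ j → 0 ≤ ∑ a ∈ blockUnion S i l, x a then
        flagSum x (MergedConditions S l 0) else 0 := by
  induction j with
  | zero =>
    rw [if_pos]
    intro i h1 h2
    omega
  | succ j ih =>
    have hiff : (∀ i, 1 ≤ i → i ≤ j + 1 → 0 ≤ ∑ a ∈ blockUnion S i l, x a) ↔
        0 ≤ ∑ a ∈ blockUnion S (j + 1) l, x a ∧
          ∀ i, 1 ≤ i → i ≤ j → 0 ≤ ∑ a ∈ blockUnion S i l, x a := by
      refine ⟨fun h => ⟨h _ (by omega) le_rfl, fun i hi hij => h i hi (by omega)⟩, ?_⟩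
      rintro ⟨h1, h2⟩ i hi hij
      rcases Nat.le_succ_iff.mp hij with h | rfl
      · exact h2 i hi h
      · exact h1
    rw [flagSum_mergedConditions_succ hS hx hjl hlk (hne _ (by omega) hjl), ih (by omega)]
    by_cases h : ∀ i, 1 ≤ i → i ≤ j + 1 → 0 ≤ ∑ a ∈ blockUnion S i l, x a
    · rw [if_pos h, if_pos (hiff.mp h).1, if_pos (hiff.mp h).2]
    · rw [if_neg h]
      split_ifs with h1 h2
      · exact absurd (hiff.mpr ⟨h1, h2⟩) h
      · rfl
      · rfl

/-- The unique flag in which the first `l` blocks lie together and are followed by the others. -/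
def initialFlag (S : Fin k → Finset (Fin n)) (l : ℕ) : Finset (Finset (Fin n)) :=
  (Finset.Ico l k).image (blockUnion S 0)

theorem IsOrderedSetPartition.blockUnion_injOn (hS : IsOrderedSetPartition S) :
    Set.InjOn (blockUnion S 0) (Set.Iio k) := by
  have key : ∀ a b : ℕ, a < b → a < k → blockUnion S 0 a ≠ blockUnion S 0 b := by
    intro a b hab ha h
    have h1 : S ⟨a, ha⟩ ⊆ blockUnion S 0 b := subset_blockUnion _ (Nat.zero_le _) hab
    rw [← h, hS.subset_blockUnion_iff] at h1
    simp at h1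
  intro a ha b hb h
  rcases lt_trichotomy a b with h' | h' | h'
  · exact absurd h (key a b h' ha)
  · exact h'
  · exact absurd h.symm (key b a h' hb)

theorem card_initialFlag (hS : IsOrderedSetPartition S) (l : ℕ) :
    (initialFlag S l).card = k - l := by
  rw [initialFlag, Finset.card_image_of_injOn, Nat.card_Ico]
  exact hS.blockUnion_injOn.mono fun i hi => (Finset.mem_Ico.mp (Finset.mem_coe.mp hi)).2

theorem isFlag_initialFlag (hS : IsOrderedSetPartition S) {l : ℕ} (hl : 1 ≤ l) :
    IsFlag (initialFlag S l) := by
  simp only [initialFlag]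
  refine ⟨?_, ?_, ?_⟩ <;> simp only [Finset.forall_mem_image, Finset.mem_Ico]
  · intro a _ b _
    exact (le_total a b).imp blockUnion_mono blockUnion_mono
  · intro a ha
    exact hS.nonempty_blockUnion (by omega) (by omega)
  · intro a ha
    exact hS.blockUnion_ne_univ ⟨a, ha.2⟩ (by simp)

theorem mergedConditions_initialFlag (hS : IsOrderedSetPartition S) {l : ℕ} (hl : 1 ≤ l) :
    MergedConditions S l 0 (initialFlag S l) := by
  have hstrict : ∀ i i' : Fin k, i < i' → l ≤ i'.val →
      StrictlyBefore (initialFlag S l) (S i) (S i') := by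
    intro i i' h hl'
    refine ⟨blockUnion S 0 i', Finset.mem_image_of_mem _ (by simp [hl']), ?_, ?_⟩
    · exact subset_blockUnion _ (Nat.zero_le _) h
    · rw [hS.disjoint_blockUnion_iff]
      simp
  refine ⟨?_, fun i hi => absurd hi (by omega), ?_, fun i i' _ h => absurd h (by omega),
    fun i i' h h' => hstrict _ _ (Fin.lt_def.mpr (by omega)) (by omega),
    fun i i' h h' => hstrict _ _ (Fin.lt_def.mpr (by omega)) (by omega)⟩
  · simp only [Unsplit, initialFlag, Finset.forall_mem_image, Finset.mem_Ico]
    exact fun a ha => Or.inl (blockUnion_mono ha.1)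
  · intro i hi
    simp only [Unsplit, initialFlag, Finset.forall_mem_image, Finset.mem_Ico,
      hS.disjoint_blockUnion_iff, hS.subset_blockUnion_iff]
    exact fun a ha => em _

/-- A member separating block `i` from its predecessor misses block `i`, so by the chain property it
lies inside any `B` containing block `i`. Hence `B` contains the predecessor, and induction reaches
down to the merged part. -/
theorem blockUnion_subset_of_mergedConditions (hS : IsOrderedSetPartition S) {l : ℕ}
    (hl : 1 ≤ l) {c : Finset (Finset (Fin n))} (hc : IsFlag c) (h : MergedConditions S l 0 c)
    {B : Finset (Fin n)} (hB : B ∈ c) (i : ℕ) (hli : l ≤ i) (hi : i < k) (hiB : S ⟨i, hi⟩ ⊆ B) :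
    blockUnion S 0 i ⊆ B := by
  obtain ⟨hM, -, -, -, h0, hs⟩ := h
  induction i, hli using Nat.le_induction with
  | base =>
    obtain ⟨A, hA, hA0, hAd⟩ := h0 ⟨0, by omega⟩ ⟨l, hi⟩ rfl rfl
    have hMA : blockUnion S 0 l ⊆ A := (hM A hA).resolve_right fun hd =>
      not_disjoint_of_subset (hS.nonempty _) hA0
        (hd.mono_left (subset_blockUnion _ (Nat.zero_le _) hl))
    rcases hc.chain A hA B hB with h | h
    · exact hMA.trans h
    · exact absurd hAd (not_disjoint_of_subset (hS.nonempty _) (hiB.trans h))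
  | succ i hli ih =>
    obtain ⟨A, hA, hA0, hAd⟩ := hs ⟨i, by omega⟩ ⟨i + 1, hi⟩ rfl hli
    have hSB : S ⟨i, by omega⟩ ⊆ B := by
      rcases hc.chain A hA B hB with h | h
      · exact hA0.trans h
      · exact absurd hAd (not_disjoint_of_subset (hS.nonempty _) (hiB.trans h))
    rw [blockUnion_succ_right (Nat.zero_le _) (by omega)]
    exact Finset.union_subset (ih (by omega) hSB) hSB

theorem eq_blockUnion_of_mergedConditions (hS : IsOrderedSetPartition S) {l : ℕ} (hl : 1 ≤ l)
    {c : Finset (Finset (Fin n))} (hc : IsFlag c)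
    (h : MergedConditions S l 0 c) {B : Finset (Fin n)} (hB : B ∈ c) :
    ∃ i, l ≤ i ∧ i < k ∧ B = blockUnion S 0 i := by
  classical
  have hsub := fun i hli hi => blockUnion_subset_of_mergedConditions hS hl hc h hB i hli hi
  obtain ⟨hM, -, hu, -, -, -⟩ := h
  have hstart : blockUnion S 0 l ⊆ B := by
    obtain ⟨t, ht⟩ := hc.nonempty B hB
    obtain ⟨i, hi⟩ := hS.cover t
    by_cases hil : i.val < l
    · refine (hM B hB).resolve_right fun hd => ?_
      exact Finset.disjoint_left.mp hd ((hS.mem_blockUnion_iff hi).mpr ⟨Nat.zero_le _, hil⟩) ht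
    · have hiB : S i ⊆ B := (hu i (by omega) B hB).resolve_right fun hd =>
        Finset.disjoint_left.mp hd hi ht
      exact (blockUnion_mono (by omega)).trans (hsub i (by omega) i.2 hiB)
  have hex : ∃ i, l ≤ i ∧ ∃ hi : i < k, ¬ S ⟨i, hi⟩ ⊆ B := by
    by_contra! hall
    refine hc.ne_univ B hB (Finset.eq_univ_of_forall fun t => ?_)
    obtain ⟨i, hi⟩ := hS.cover t
    by_cases hil : i.val < l
    · exact hstart ((hS.mem_blockUnion_iff hi).mpr ⟨Nat.zero_le _, hil⟩)
    · exact hall i (by omega) i.2 hi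
  -- The first block missing from `B` determines `B`: all earlier blocks are inside, and a later one
  -- inside would force this one in.
  obtain ⟨hli, hik, hiB⟩ := Nat.find_spec hex
  refine ⟨Nat.find hex, hli, hik, Finset.Subset.antisymm ?_ ?_⟩
  · intro t ht
    obtain ⟨i, hi⟩ := hS.cover t
    rw [hS.mem_blockUnion_iff hi]
    refine ⟨Nat.zero_le _, ?_⟩
    by_contra hlt
    have hiB' : S i ⊆ B := (hu i (by omega) B hB).resolve_right fun hd =>
        Finset.disjoint_left.mp hd hi ht
    apply hiB
    rcases Nat.eq_or_lt_of_le (not_lt.mp hlt) with heq | hlt'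
    · have : (⟨Nat.find hex, hik⟩ : Fin k) = i := Fin.ext heq
      rwa [this]
    · exact (subset_blockUnion _ (Nat.zero_le _) hlt').trans (hsub i (by omega) i.2 hiB')
  · intro t ht
    obtain ⟨i, ⟨-, hi⟩, hti⟩ := mem_blockUnion.mp ht
    by_cases hil : i.val < l
    · exact hstart ((hS.mem_blockUnion_iff hti).mpr ⟨Nat.zero_le _, hil⟩)
    · have := Nat.find_min hex hi
      push Not at this
      exact this (by omega) i.2 hti

theorem mergedConditions_zero_iff (hS : IsOrderedSetPartition S) {l : ℕ} (hl : 1 ≤ l)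
    {c : Finset (Finset (Fin n))} (hc : IsFlag c) :
    MergedConditions S l 0 c ↔ c = initialFlag S l := by
  refine ⟨fun h => ?_, fun h => h ▸ mergedConditions_initialFlag hS hl⟩
  have heq := fun B hB => eq_blockUnion_of_mergedConditions hS hl hc h (B := B) hB
  obtain ⟨hM, -, hu, -, h0, hs⟩ := h
  ext B
  simp only [initialFlag, Finset.mem_image, Finset.mem_Ico]
  constructor
  · intro hB
    obtain ⟨i, h1, h2, h3⟩ := heq B hB
    exact ⟨i, ⟨h1, h2⟩, h3.symm⟩
  · rintro ⟨i, ⟨hli, hi⟩, rfl⟩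
    -- Each initial union must occur: the member witnessing strictness just before block `i` is
    -- itself an initial union, and its two constraints fix its index as `i`. At `i = l` the witness
    -- comes from the pair of positions `0` and `l`.
    rcases Nat.eq_or_lt_of_le hli with rfl | hlt
    · obtain ⟨A, hA, hA0, hAd⟩ := h0 ⟨0, by omega⟩ ⟨l, hi⟩ rfl rfl
      obtain ⟨i', h1, h2, rfl⟩ := heq A hA
      rw [hS.disjoint_blockUnion_iff] at hAd
      obtain rfl : l = i' := by simp at hAd; omega
      exact hA
    · obtain ⟨A, hA, hA0, hAd⟩ := hs ⟨i - 1, by omega⟩ ⟨i, hi⟩ (by simp; omega) (by simp; omega)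
      obtain ⟨i', h1, h2, rfl⟩ := heq A hA
      rw [hS.disjoint_blockUnion_iff] at hAd
      rw [hS.subset_blockUnion_iff] at hA0
      obtain rfl : i = i' := by simp at hAd hA0; omega
      exact hA

open scoped Classical in
theorem flagSum_mergedConditions_zero (hS : IsOrderedSetPartition S) (x : Fin n → ℝ) {l : ℕ}
    (hl : 1 ≤ l) :
    flagSum x (MergedConditions S l 0) =
      if ∀ i, l ≤ i → i < k → 0 ≤ ∑ a ∈ blockUnion S 0 i, x a then (-1) ^ (k - l) else 0 := by
  classical
  have hiff : ∀ c, IsNonnegFlag x c ∧ MergedConditions S l 0 c ↔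
      c = initialFlag S l ∧ ∀ i, l ≤ i → i < k → 0 ≤ ∑ a ∈ blockUnion S 0 i, x a := by
    intro c
    constructor
    · rintro ⟨h1, h2⟩
      obtain rfl := (mergedConditions_zero_iff hS hl h1.1).mp h2
      exact ⟨rfl, fun i hi hi' =>
        h1.2 _ (Finset.mem_image_of_mem _ (Finset.mem_Ico.mpr ⟨hi, hi'⟩))⟩
    · rintro ⟨rfl, h⟩
      refine ⟨⟨isFlag_initialFlag hS hl, ?_⟩, mergedConditions_initialFlag hS hl⟩
      simp only [initialFlag, Finset.forall_mem_image, Finset.mem_Ico]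
      exact fun i hi => h i hi.1 hi.2
  unfold flagSum
  split_ifs with h
  · rw [Finset.sum_eq_single_of_mem (initialFlag S l) (by simpa [hiff] using h),
      card_initialFlag hS]
    intro c hc hne
    exact absurd ((hiff c).mp (Finset.mem_filter.mp hc).2).1 hne
  · refine Finset.sum_eq_zero fun c hc => ?_
    exact absurd ((hiff c).mp (Finset.mem_filter.mp hc).2).2 h

end Blocks

/-! ### The bijection between ordered set partitions and flags -/

section FlagOfPartition

variable {n k : ℕ} {S : Fin k → Finset (Fin n)}

/-- The flag of the partial unions of blocks of an ordered set partition. -/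
def OrderedSetPartition.flag (P : OrderedSetPartition n) : Finset (Finset (Fin n)) :=
  initialFlag P.block 1

theorem OrderedSetPartition.mem_flag {P : OrderedSetPartition n} {B : Finset (Fin n)} :
    B ∈ P.flag ↔ ∃ j, (1 ≤ j ∧ j < P.len) ∧ blockUnion P.block 0 j = B := by
  simp [OrderedSetPartition.flag, initialFlag]

theorem OrderedSetPartition.one_le_len [NeZero n] (P : OrderedSetPartition n) : 1 ≤ P.len := by
  obtain ⟨i, -⟩ := P.isOrderedSetPartition.cover 0
  exact (Nat.zero_le i.val).trans_lt i.2

theorem OrderedSetPartition.mem_plate_iff {P : OrderedSetPartition n} {x : V0 n} :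
    x ∈ P.plate ↔ ∀ B ∈ P.flag, 0 ≤ ∑ a ∈ B, x.val a := by
  simp only [OrderedSetPartition.mem_flag, OrderedSetPartition.plate, blockUnion]
  constructor
  · rintro h B ⟨j, ⟨h1, h2⟩, rfl⟩
    simpa using h j h1 h2
  · intro h j h1 h2
    simpa using h _ ⟨j, ⟨h1, h2⟩, rfl⟩

/-- The number of members of a flag that do not contain a given element. -/
def flagRank (c : Finset (Finset (Fin n))) (a : Fin n) : ℕ := (c.filter (a ∉ ·)).card

/-- The partial unions missing an element of block `i` are those of the first `1, …, i` blocks.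
Ranks therefore recover the blocks from the flag. -/
theorem OrderedSetPartition.flagRank_flag (P : OrderedSetPartition n) {i : Fin P.len} {a : Fin n}
    (ha : a ∈ P.block i) : flagRank P.flag a = i := by
  have hP := P.isOrderedSetPartition
  have : P.flag.filter (a ∉ ·) = (Finset.Ico 1 (i.val + 1)).image (blockUnion P.block 0) := by
    ext B
    simp only [Finset.mem_filter, OrderedSetPartition.mem_flag, Finset.mem_image, Finset.mem_Ico]
    constructor
    · rintro ⟨⟨j, ⟨h1, h2⟩, rfl⟩, h3⟩
      rw [hP.mem_blockUnion_iff ha] at h3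
      exact ⟨j, by omega, rfl⟩
    · rintro ⟨j, h, rfl⟩
      refine ⟨⟨j, by omega, rfl⟩, ?_⟩
      rw [hP.mem_blockUnion_iff ha]
      omega
  rw [flagRank, this, Finset.card_image_of_injOn, Nat.card_Ico]
  · rfl
  · refine hP.blockUnion_injOn.mono fun j hj => ?_
    have := (Finset.mem_Ico.mp (Finset.mem_coe.mp hj)).2
    exact Set.mem_Iio.mpr (by omega)

theorem OrderedSetPartition.flag_injective [NeZero n] :
    Function.Injective (OrderedSetPartition.flag (n := n)) := by
  intro P P' h
  have hlen : P.len = P'.len := by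
    have h1 := card_initialFlag P.isOrderedSetPartition 1
    have h2 := card_initialFlag P'.isOrderedSetPartition 1
    have h3 : (initialFlag P.block 1).card = (initialFlag P'.block 1).card :=
      congrArg Finset.card h
    have h4 := P.one_le_len
    have h5 := P'.one_le_len
    omega
  have hmem : ∀ (P : OrderedSetPartition n) (i : Fin P.len) (a : Fin n),
      a ∈ P.block i ↔ flagRank P.flag a = i := by
    intro P i a
    refine ⟨P.flagRank_flag, fun h => ?_⟩
    obtain ⟨j, hj⟩ := P.isOrderedSetPartition.cover a
    rw [P.flagRank_flag hj] at h
    rwa [← Fin.ext h]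
  have hblock : ∀ i : Fin P.len, P.block i = P'.block (Fin.cast hlen i) := by
    intro i
    ext a
    rw [hmem, hmem, h]
    rfl
  obtain ⟨m, f, hf⟩ := P
  obtain ⟨m', f', hf'⟩ := P'
  obtain rfl : m = m' := hlen
  obtain rfl : f = f' := funext hblock
  rfl

theorem IsFlag.flagRank_le {c : Finset (Finset (Fin n))} (hc : IsFlag c) {B : Finset (Fin n)}
    {a : Fin n} (ha : a ∈ B) (hB : B ∈ c) : flagRank c a ≤ (c.filter (· ⊂ B)).card := by
  refine Finset.card_le_card fun A hA => ?_
  simp only [Finset.mem_filter] at hA ⊢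
  refine ⟨hA.1, ?_⟩
  rcases hc.chain A hA.1 B hB with h | h
  · exact ⟨h, fun h' => hA.2 (h' ha)⟩
  · exact absurd (h ha) hA.2

theorem lt_flagRank {c : Finset (Finset (Fin n))} {B : Finset (Fin n)}
    {a : Fin n} (ha : a ∉ B) (hB : B ∈ c) : (c.filter (· ⊂ B)).card < flagRank c a := by
  refine Finset.card_lt_card ⟨fun A hA => ?_, fun h => ?_⟩
  · simp only [Finset.mem_filter] at hA ⊢
    exact ⟨hA.1, fun h => ha (hA.2.1 h)⟩
  · have := h (Finset.mem_filter.mpr ⟨hB, ha⟩)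
    exact (Finset.mem_filter.mp this).2.2 subset_rfl

/-- Counting smaller members is strictly monotone on a chain, hence injective into `range c.card`,
hence onto it. -/
theorem IsFlag.exists_card_ssubset_eq {c : Finset (Finset (Fin n))} (hc : IsFlag c) {i : ℕ}
    (hi : i < c.card) : ∃ B ∈ c, (c.filter (· ⊂ B)).card = i := by
  have hmaps : Set.MapsTo (fun B => (c.filter (· ⊂ B)).card) (c : Set (Finset (Fin n)))
      (Finset.range c.card : Set ℕ) := by
    intro B hB
    simp only [Finset.coe_range, Set.mem_Iio]
    refine Finset.card_lt_card ⟨Finset.filter_subset _ _, fun h => ?_⟩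
    exact (Finset.mem_filter.mp (h hB)).2.2 subset_rfl
  have hlt : ∀ A ∈ c, ∀ B ∈ c, A ⊂ B → (c.filter (· ⊂ A)).card < (c.filter (· ⊂ B)).card := by
    intro A hA B hB h
    refine Finset.card_lt_card ⟨fun D hD => ?_, fun h' => ?_⟩
    · simp only [Finset.mem_filter] at hD ⊢
      exact ⟨hD.1, hD.2.trans h⟩
    · exact (Finset.mem_filter.mp (h' (Finset.mem_filter.mpr ⟨hA, h⟩))).2.2 subset_rfl
  have hinj : Set.InjOn (fun B => (c.filter (· ⊂ B)).card) (c : Set (Finset (Fin n))) := by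
    intro A hA B hB h
    by_contra hne
    rcases hc.chain A hA B hB with h' | h'
    · exact (hlt A hA B hB (h'.ssubset_of_ne hne)).ne h
    · exact (hlt B hB A hA (h'.ssubset_of_ne (Ne.symm hne))).ne h.symm
  obtain ⟨B, hB, h⟩ := Finset.surjOn_of_injOn_of_card_le _ hmaps hinj (by simp)
    (Finset.mem_coe.mpr (Finset.mem_range.mpr hi))
  exact ⟨B, hB, h⟩

theorem IsFlag.exists_flagRank_eq [NeZero n] {c : Finset (Finset (Fin n))} (hc : IsFlag c) {i : ℕ}
    (hi : i ≤ c.card) : ∃ a, flagRank c a = i := by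
  have hle : ∀ a, flagRank c a ≤ c.card := fun a => Finset.card_filter_le _ _
  rcases Nat.eq_zero_or_pos i with rfl | hpos
  · rcases Nat.eq_zero_or_pos c.card with h | h
    · exact ⟨0, by have := hle 0; omega⟩
    · obtain ⟨B, hB, hB'⟩ := hc.exists_card_ssubset_eq h
      obtain ⟨a, ha⟩ := hc.nonempty B hB
      exact ⟨a, by have := hc.flagRank_le ha hB; omega⟩
  · obtain ⟨A, hA, hA'⟩ := hc.exists_card_ssubset_eq (i := i - 1) (by omega)
    rcases Nat.eq_or_lt_of_le hi with h | h
    · obtain ⟨a, ha⟩ : ∃ a, a ∉ A := by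
        by_contra! h
        exact hc.ne_univ A hA (Finset.eq_univ_of_forall h)
      refine ⟨a, ?_⟩
      have h1 := hle a
      have h2 := lt_flagRank ha hA
      omega
    · obtain ⟨B, hB, hB'⟩ := hc.exists_card_ssubset_eq h
      -- Rank `i` is realised by any element gained between two consecutive members `A ⊂ B` of the
      -- chain.
      obtain ⟨a, haB, haA⟩ : ∃ a ∈ B, a ∉ A := by
        by_contra! h
        have : (c.filter (· ⊂ B)).card ≤ (c.filter (· ⊂ A)).card :=
          Finset.card_le_card fun D hD => by
            simp only [Finset.mem_filter] at hD ⊢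
            exact ⟨hD.1, hD.2.trans_subset h⟩
        omega
      refine ⟨a, ?_⟩
      have h1 := hc.flagRank_le haB hB
      have h2 := lt_flagRank haA hA
      omega

/-- The ordered set partition whose partial unions of blocks form a given flag. -/
def IsFlag.toOrderedSetPartition [NeZero n] {c : Finset (Finset (Fin n))} (hc : IsFlag c) :
    OrderedSetPartition n where
  len := c.card + 1
  block i := Finset.univ.filter fun a => flagRank c a = i
  isOrderedSetPartition :=
    { nonempty := fun i => by
        obtain ⟨a, ha⟩ := hc.exists_flagRank_eq (Nat.lt_succ_iff.mp i.2)
        exact ⟨a, by simpa using ha⟩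
      disjoint := fun i j hij => by
        rw [Finset.disjoint_left]
        intro a hi hj
        simp only [Finset.mem_filter, Finset.mem_univ, true_and] at hi hj
        exact hij (Fin.ext (hi.symm.trans hj))
      cover := fun a =>
        ⟨⟨flagRank c a, Nat.lt_succ_of_le (Finset.card_filter_le _ _)⟩, by simp⟩ }

theorem IsFlag.flag_toOrderedSetPartition [NeZero n] {c : Finset (Finset (Fin n))}
    (hc : IsFlag c) : hc.toOrderedSetPartition.flag = c := by
  symm
  -- The cardinalities agree by construction, so one inclusion suffices.
  apply Finset.eq_of_subset_of_card_le
  · intro B hB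
    rw [OrderedSetPartition.mem_flag]
    refine ⟨(c.filter (· ⊂ B)).card + 1, ⟨by omega, Nat.succ_lt_succ ?_⟩, ?_⟩
    · refine Finset.card_lt_card ⟨Finset.filter_subset _ _, fun h => ?_⟩
      exact (Finset.mem_filter.mp (h hB)).2.2 subset_rfl
    · ext a
      have ha : a ∈ hc.toOrderedSetPartition.block
          ⟨flagRank c a, Nat.lt_succ_of_le (Finset.card_filter_le _ _)⟩ := by
        simp [IsFlag.toOrderedSetPartition]
      rw [hc.toOrderedSetPartition.isOrderedSetPartition.mem_blockUnion_iff ha]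
      constructor
      · intro h
        by_contra h'
        have := lt_flagRank h' hB
        simp only at h
        omega
      · intro h
        have := hc.flagRank_le h hB
        simp only
        omega
  · have := card_initialFlag hc.toOrderedSetPartition.isOrderedSetPartition 1
    exact this.le

theorem OrderedSetPartition.subset_blockUnion_iff (P : OrderedSetPartition n)
    {T : Finset (Fin n)} (hT : T.Nonempty) {q : Fin P.len} (hq : T ⊆ P.block q) (j : ℕ) :
    T ⊆ blockUnion P.block 0 j ↔ q.val < j := by
  constructor
  · intro h
    obtain ⟨t, ht⟩ := hT
    exact ((P.isOrderedSetPartition.mem_blockUnion_iff (hq ht)).mp (h ht)).2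
  · exact fun h => hq.trans (subset_blockUnion q (Nat.zero_le _) h)

theorem OrderedSetPartition.disjoint_blockUnion_iff (P : OrderedSetPartition n)
    {T : Finset (Fin n)} (hT : T.Nonempty) {q : Fin P.len} (hq : T ⊆ P.block q) (j : ℕ) :
    Disjoint T (blockUnion P.block 0 j) ↔ j ≤ q.val := by
  constructor
  · intro h
    obtain ⟨t, ht⟩ := hT
    by_contra h'
    exact Finset.disjoint_left.mp h ht
      ((P.isOrderedSetPartition.mem_blockUnion_iff (hq ht)).mpr ⟨Nat.zero_le _, by omega⟩)
  · intro h
    refine Finset.disjoint_of_subset_left hq ?_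
    rw [P.isOrderedSetPartition.disjoint_blockUnion_iff]
    omega

theorem OrderedSetPartition.unsplit_flag_iff (P : OrderedSetPartition n) {T : Finset (Fin n)}
    (hT : T.Nonempty) : Unsplit P.flag T ↔ ∃ q, T ⊆ P.block q := by
  constructor
  · intro h
    obtain ⟨t, ht⟩ := hT
    obtain ⟨q, hq⟩ := P.isOrderedSetPartition.cover t
    refine ⟨q, fun s hs => ?_⟩
    obtain ⟨r, hr⟩ := P.isOrderedSetPartition.cover s
    have key : ∀ B ∈ P.flag, (t ∈ B ↔ s ∈ B) := by
      intro B hB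
      rcases h B hB with h | h
      · exact ⟨fun _ => h hs, fun _ => h ht⟩
      · exact ⟨fun h' => absurd h' (Finset.disjoint_left.mp h ht),
          fun h' => absurd h' (Finset.disjoint_left.mp h hs)⟩
    -- Elements not separated by any member have equal rank, hence share a block.
    have : flagRank P.flag t = flagRank P.flag s := by
      unfold flagRank
      congr 1
      exact Finset.filter_congr fun B hB => (key B hB).not
    rw [P.flagRank_flag hq, P.flagRank_flag hr] at this
    rwa [Fin.ext this]
  · rintro ⟨q, hq⟩ B hB
    obtain ⟨j, hj, rfl⟩ := OrderedSetPartition.mem_flag.mp hB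
    rw [P.subset_blockUnion_iff hT hq, P.disjoint_blockUnion_iff hT hq]
    omega

theorem OrderedSetPartition.weaklyBefore_flag_iff (P : OrderedSetPartition n)
    {Y Z : Finset (Fin n)} (hY : Y.Nonempty) (hZ : Z.Nonempty) {p q : Fin P.len}
    (hp : Y ⊆ P.block p) (hq : Z ⊆ P.block q) : WeaklyBefore P.flag Y Z ↔ p ≤ q := by
  constructor
  · intro h
    by_contra hlt
    have hlt' : q.val < p.val := by simpa using hlt
    have := h (blockUnion P.block 0 p) (OrderedSetPartition.mem_flag.mpr ⟨p, ⟨by omega, p.2⟩, rfl⟩)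
    rw [P.subset_blockUnion_iff hY hp, P.subset_blockUnion_iff hZ hq] at this
    omega
  · intro h B hB
    obtain ⟨j, hj, rfl⟩ := OrderedSetPartition.mem_flag.mp hB
    rw [P.subset_blockUnion_iff hY hp, P.subset_blockUnion_iff hZ hq]
    exact fun h' => lt_of_le_of_lt h h'

theorem OrderedSetPartition.strictlyBefore_flag_iff (P : OrderedSetPartition n)
    {Y Z : Finset (Fin n)} (hY : Y.Nonempty) (hZ : Z.Nonempty) {p q : Fin P.len}
    (hp : Y ⊆ P.block p) (hq : Z ⊆ P.block q) : StrictlyBefore P.flag Y Z ↔ p < q := by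
  constructor
  · rintro ⟨B, hB, h1, h2⟩
    obtain ⟨j, hj, rfl⟩ := OrderedSetPartition.mem_flag.mp hB
    rw [P.subset_blockUnion_iff hY hp] at h1
    rw [P.disjoint_blockUnion_iff hZ hq] at h2
    exact Fin.lt_def.mpr (by omega)
  · intro h
    have hlt : p.val < q.val := h
    refine ⟨blockUnion P.block 0 q,
      OrderedSetPartition.mem_flag.mpr ⟨q, ⟨by omega, q.2⟩, rfl⟩, ?_⟩
    rw [P.subset_blockUnion_iff hY hp, P.disjoint_blockUnion_iff hZ hq]
    omega

theorem satisfiesOrientations_iff (hS : IsOrderedSetPartition S) {l : ℕ} (hl : 1 ≤ l)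
    (hlk : l ≤ k) (P : OrderedSetPartition n) :
    SatisfiesOrientations l S P ↔ MergedConditions S l (l - 1) P.flag := by
  -- At `j = l - 1` the merged part is the single block at position `l - 1`, so nothing has been
  -- merged yet.
  have hmerged : MergedConditions S l (l - 1) P.flag ↔ OutsideConditions S l l P.flag := by
    obtain ⟨m, rfl⟩ : ∃ m, l = m + 1 := ⟨l - 1, by omega⟩
    have hb : blockUnion S m (m + 1) = S ⟨m, by omega⟩ := by
      rw [blockUnion_succ_right le_rfl (by omega)]
      have : blockUnion S m m = ∅ := by
        ext t
        simp only [mem_blockUnion, Finset.notMem_empty, iff_false]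
        rintro ⟨i, h, -⟩
        omega
      rw [this, Finset.empty_union]
    rw [outsideConditions_succ (j := m) (by omega), MergedConditions, Nat.add_sub_cancel, hb]
  rw [hmerged]
  constructor
  · rintro ⟨p, hp, h1, h2, h3⟩
    refine ⟨fun i _ => (P.unsplit_flag_iff (hS.nonempty i)).mpr ⟨p i, hp i⟩, ?_, ?_, ?_⟩
    · exact fun i i' h h' => (P.weaklyBefore_flag_iff (hS.nonempty i) (hS.nonempty i')
        (hp i) (hp i')).mpr (h1 i i' h h')
    · exact fun i i' h h' => (P.strictlyBefore_flag_iff (hS.nonempty i) (hS.nonempty i')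
        (hp i) (hp i')).mpr (h2 i i' h h')
    · exact fun i i' h h' => (P.strictlyBefore_flag_iff (hS.nonempty i) (hS.nonempty i')
        (hp i) (hp i')).mpr (h3 i i' h h')
  · rintro ⟨hu, h1, h2, h3⟩
    choose p hp using fun i => (P.unsplit_flag_iff (hS.nonempty i)).mp (hu i (lt_or_ge _ _))
    refine ⟨p, hp, ?_, ?_, ?_⟩
    · exact fun i i' h h' => (P.weaklyBefore_flag_iff (hS.nonempty i) (hS.nonempty i')
        (hp i) (hp i')).mp (h1 i i' h h')
    · exact fun i i' h h' => (P.strictlyBefore_flag_iff (hS.nonempty i) (hS.nonempty i')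
        (hp i) (hp i')).mp (h2 i i' h h')
    · exact fun i i' h h' => (P.strictlyBefore_flag_iff (hS.nonempty i) (hS.nonempty i')
        (hp i) (hp i')).mp (h3 i i' h h')

end FlagOfPartition

/-! ### The inequalities of the reversed plate -/

section ReverseInitial

variable {n k l : ℕ} {S : Fin k → Finset (Fin n)}

/-- The position of the `i`-th entry of a sequence after its first `l` entries are reversed. -/
def reversePosition (hlk : l ≤ k) (i : Fin k) : Fin k :=
  ⟨if i.val < l then l - 1 - i.val else i.val, by split_ifs <;> omega⟩

theorem reverseInitial_reversePosition {α : Type} (hlk : l ≤ k) (S : Fin k → α) (i : Fin k) :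
    reverseInitial l hlk S (reversePosition hlk i) = S i := by
  unfold reverseInitial
  by_cases h : i.val < l
  · have hval : (reversePosition hlk i).val = l - 1 - i.val := if_pos h
    rw [dif_pos (by omega)]
    congr 1
    exact Fin.ext (by simp only [hval]; omega)
  · have hval : reversePosition hlk i = i := Fin.ext (if_neg h)
    rw [hval, dif_neg h]

theorem reversePosition_injective (hlk : l ≤ k) : Function.Injective (reversePosition hlk) := by
  intro i j h
  have := congrArg Fin.val h
  simp only [reversePosition] at this
  ext
  split_ifs at this <;> omega

theorem IsOrderedSetPartition.of_reverseInitial {hlk : l ≤ k}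
    (hS : IsOrderedSetPartition (reverseInitial l hlk S)) : IsOrderedSetPartition S where
  nonempty i := by
    rw [← reverseInitial_reversePosition hlk S i]
    exact hS.nonempty _
  disjoint i j hij := by
    rw [← reverseInitial_reversePosition hlk S i, ← reverseInitial_reversePosition hlk S j]
    exact hS.disjoint _ _ ((reversePosition_injective hlk).ne hij)
  cover a := by
    obtain ⟨i, hi⟩ := hS.cover a
    obtain ⟨j, rfl⟩ := (Finite.injective_iff_surjective.mp (reversePosition_injective hlk)) i
    exact ⟨j, by rwa [reverseInitial_reversePosition] at hi⟩

theorem mem_blockUnion_reverseInitial {hlk : l ≤ k}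
    (hS : IsOrderedSetPartition (reverseInitial l hlk S)) {j : ℕ} {i : Fin k} {t : Fin n}
    (ht : t ∈ S i) :
    t ∈ blockUnion (reverseInitial l hlk S) 0 j ↔ (reversePosition hlk i).val < j := by
  rw [hS.mem_blockUnion_iff (i := reversePosition hlk i)
    (by rwa [reverseInitial_reversePosition])]
  simp

theorem blockUnion_reverseInitial_of_le {hlk : l ≤ k}
    (hS : IsOrderedSetPartition (reverseInitial l hlk S)) {j : ℕ} (hj : j ≤ l) :
    blockUnion (reverseInitial l hlk S) 0 j = blockUnion S (l - j) l := by
  ext t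
  obtain ⟨i, hi⟩ := hS.of_reverseInitial.cover t
  rw [mem_blockUnion_reverseInitial hS hi, hS.of_reverseInitial.mem_blockUnion_iff hi]
  simp only [reversePosition]
  split_ifs <;> omega

theorem blockUnion_reverseInitial_of_ge {hlk : l ≤ k}
    (hS : IsOrderedSetPartition (reverseInitial l hlk S)) {j : ℕ} (hj : l ≤ j) :
    blockUnion (reverseInitial l hlk S) 0 j = blockUnion S 0 j := by
  ext t
  obtain ⟨i, hi⟩ := hS.of_reverseInitial.cover t
  rw [mem_blockUnion_reverseInitial hS hi, hS.of_reverseInitial.mem_blockUnion_iff hi]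
  simp only [reversePosition]
  split_ifs <;> omega

/-- Prefixes shorter than `l` are the merged parts tested during the recursion; the longer ones are
the members of the surviving flag. -/
theorem mem_plate_reverseInitial_iff (hl : 1 ≤ l) (hlk : l ≤ k)
    (hS : IsOrderedSetPartition (reverseInitial l hlk S)) (x : V0 n) :
    x ∈ (OrderedSetPartition.mk k (reverseInitial l hlk S) hS).plate ↔
      (∀ i, 1 ≤ i → i ≤ l - 1 → 0 ≤ ∑ a ∈ blockUnion S i l, x.val a) ∧
      ∀ i, l ≤ i → i < k → 0 ≤ ∑ a ∈ blockUnion S 0 i, x.val a := by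
  simp only [OrderedSetPartition.mem_plate_iff, OrderedSetPartition.mem_flag]
  constructor
  · intro h
    refine ⟨fun i h1 h2 => ?_, fun i h1 h2 => ?_⟩
    · refine h _ ⟨l - i, by omega, ?_⟩
      rw [blockUnion_reverseInitial_of_le hS (by omega)]
      congr 1
      omega
    · exact h _ ⟨i, by omega, blockUnion_reverseInitial_of_ge hS h1⟩
  · rintro ⟨h1, h2⟩ B ⟨j, hj, rfl⟩
    rcases lt_or_ge j l with h | h
    · rw [blockUnion_reverseInitial_of_le hS h.le]
      exact h1 _ (by omega) (by omega)
    · rw [blockUnion_reverseInitial_of_ge hS h]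
      exact h2 _ h hj.2

end ReverseInitial

/-! ### The exceptional null set -/

section Negligible

variable {n : ℕ}

/-- The points of `V₀ⁿ` with a vanishing coordinate sum over some proper nonempty subset. -/
def nongeneric (n : ℕ) : Set (V0 n) :=
  {x | ∃ B : Finset (Fin n), (B.Nonempty ∧ B ≠ Finset.univ) ∧ ∑ a ∈ B, x.val a = 0}

theorem measure_nongeneric (n : ℕ) : (Measure.addHaar : Measure (V0 n)) (nongeneric n) = 0 := by
  have hsub : nongeneric n ⊆ ⋃ B : {B : Finset (Fin n) // B.Nonempty ∧ B ≠ Finset.univ},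
      {x : V0 n | ∑ a ∈ B.val, x.val a = 0} := by
    rintro x ⟨B, hB, hx⟩
    exact Set.mem_iUnion.mpr ⟨⟨B, hB⟩, hx⟩
  refine measure_mono_null hsub (measure_iUnion_null ?_)
  rintro ⟨B, ⟨a, ha⟩, hB⟩
  obtain ⟨b, hb⟩ : ∃ b, b ∉ B := by
    by_contra! h
    exact hB (Finset.eq_univ_of_forall h)
  let f : V0 n →ₗ[ℝ] ℝ :=
    (∑ a ∈ B, LinearMap.proj (R := ℝ) (φ := fun _ : Fin n => ℝ) a) ∘ₗ (V0 n).subtype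
  have hf : ∀ x, f x = ∑ a ∈ B, x.val a := by
    intro x
    simp [f]
  have hker : (LinearMap.ker f : Set (V0 n)) = {x : V0 n | ∑ a ∈ B, x.val a = 0} := by
    ext x
    simp [hf]
  rw [← hker]
  refine Measure.addHaar_submodule _ _ fun htop => ?_
  -- With `a ∈ B` and `b ∉ B`, this vector of `V0 n` has sum `1` over `B`, so the hyperplane is
  -- proper.
  have hmem : (Pi.single a 1 - Pi.single b 1 : Fin n → ℝ) ∈ V0 n := by
    change ∑ i, (Pi.single a 1 - Pi.single b 1 : Fin n → ℝ) i = 0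
    simp
  have h0 : f ⟨_, hmem⟩ = 0 := by
    rw [← LinearMap.mem_ker, htop]
    exact Submodule.mem_top
  rw [hf] at h0
  simp [ha, hb] at h0

end Negligible

/-! ### The pointwise identity and the theorem -/

section Expansion

variable {n k l : ℕ} {S : Fin k → Finset (Fin n)}

theorem OrderedSetPartition.charFun_eq_ite {P : OrderedSetPartition n} {x : V0 n}
    [Decidable (x ∈ P.plate)] : P.charFun x = if x ∈ P.plate then 1 else 0 := by
  classical
  simp only [OrderedSetPartition.charFun, Set.indicator_apply, Pi.one_apply]

theorem sum_orientedPartitions_eq_flagSum [NeZero n] (hS : IsOrderedSetPartition S) (hl : 1 ≤ l)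
    (hlk : l ≤ k) (x : V0 n) :
    ∑ π ∈ orientedPartitions l S, (-1 : ℂ) ^ π.flag.card * π.charFun x =
      flagSum x.val (MergedConditions S l (l - 1)) := by
  classical
  simp only [OrderedSetPartition.charFun_eq_ite, mul_ite, mul_one, mul_zero]
  rw [← Finset.sum_filter, flagSum]
  refine Finset.sum_nbij OrderedSetPartition.flag ?_
    OrderedSetPartition.flag_injective.injOn ?_ fun _ _ => rfl
  · intro π hπ
    simp only [orientedPartitions, Finset.mem_filter, Set.Finite.mem_toFinset] at hπ
    simp only [Finset.mem_filter, Finset.mem_univ, true_and]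
    exact ⟨⟨isFlag_initialFlag π.isOrderedSetPartition le_rfl,
      OrderedSetPartition.mem_plate_iff.mp hπ.2⟩, (satisfiesOrientations_iff hS hl hlk π).mp hπ.1⟩
  · intro c hc
    simp only [Finset.coe_filter, Finset.mem_univ, true_and] at hc
    obtain ⟨⟨hf, hpos⟩, hm⟩ := hc
    refine ⟨hf.toOrderedSetPartition, ?_, hf.flag_toOrderedSetPartition⟩
    simp only [orientedPartitions, Finset.coe_filter, Set.Finite.mem_toFinset]
    refine ⟨(satisfiesOrientations_iff hS hl hlk _).mpr ?_,
      OrderedSetPartition.mem_plate_iff.mpr ?_⟩ <;>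
    rwa [hf.flag_toOrderedSetPartition]

/-- The integer exponent may be negative; it differs from `(k - l) + (len - 1)` by the even number
`2 * len`. -/
theorem neg_one_zpow_len [NeZero n] (hlk : l ≤ k) (P : OrderedSetPartition n) :
    (-1 : ℂ) ^ ((k : ℤ) - (l : ℤ) - 1 - (P.len : ℤ)) = (-1) ^ (k - l) * (-1) ^ P.flag.card := by
  have hcard : P.flag.card = P.len - 1 := card_initialFlag P.isOrderedSetPartition 1
  have h1 := P.one_le_len
  have hexp : (k : ℤ) - l - 1 - P.len = ((k - l : ℕ) : ℤ) + ((P.len - 1 : ℕ) : ℤ) - 2 * P.len := by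
    omega
  have h0 : (-1 : ℂ) ≠ 0 := by norm_num
  rw [hexp, zpow_sub₀ h0, zpow_add₀ h0, hcard, zpow_mul]
  simp

theorem charFun_reverseInitial (hl : 1 ≤ l) (hlk : l ≤ k)
    (hS : IsOrderedSetPartition (reverseInitial l hlk S)) {x : V0 n} (hx : x ∉ nongeneric n) :
    (OrderedSetPartition.mk k (reverseInitial l hlk S) hS).charFun x =
      ∑ π ∈ orientedPartitions l S,
        (-1 : ℂ) ^ ((k : ℤ) - (l : ℤ) - 1 - (π.len : ℤ)) * π.charFun x := by
  classical
  have hS' := hS.of_reverseInitial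
  obtain ⟨t, -⟩ := hS'.nonempty ⟨0, by omega⟩
  -- Since `1 ≤ l ≤ k` there is a block, and it is nonempty. For `n = 0` the empty flag would not
  -- yield a partition into nonempty blocks.
  have : NeZero n := ⟨fun h => (h ▸ t).elim0⟩
  have hne : ∀ j, 1 ≤ j → j < l → ∑ a ∈ blockUnion S j l, x.val a ≠ 0 := fun j h1 h2 h =>
    hx ⟨_, ⟨hS'.nonempty_blockUnion h2 (by omega),
      hS'.blockUnion_ne_univ ⟨0, by omega⟩ (by simp; omega)⟩, h⟩
  simp only [neg_one_zpow_len hlk, mul_assoc]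
  rw [← Finset.mul_sum, sum_orientedPartitions_eq_flagSum hS' hl hlk,
    flagSum_mergedConditions hS' x.2 hlk hne (l - 1) (by omega),
    flagSum_mergedConditions_zero hS' _ hl, OrderedSetPartition.charFun_eq_ite]
  have hiff := mem_plate_reverseInitial_iff hl hlk hS x
  by_cases h1 : ∀ i, 1 ≤ i → i ≤ l - 1 → 0 ≤ ∑ a ∈ blockUnion S i l, x.val a
  · by_cases h2 : ∀ i, l ≤ i → i < k → 0 ≤ ∑ a ∈ blockUnion S 0 i, x.val a
    -- The global sign meets the equal sign of the surviving flag, and their product is `1`.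
    · rw [if_pos (hiff.mpr ⟨h1, h2⟩), if_pos h1, if_pos h2, ← mul_pow]
      norm_num
    · rw [if_neg fun h => h2 (hiff.mp h).2, if_pos h1, if_neg h2, mul_zero]
  · rw [if_neg fun h => h1 (hiff.mp h).1, if_neg h1, mul_zero]

end Expansion

theorem corollary6p2 (n k l : ℕ) (hl : 1 ≤ l) (hlk : l ≤ k) (S : Fin k → Finset (Fin n))
    (hS : IsOrderedSetPartition (reverseInitial l hlk S)) :
    (OrderedSetPartition.mk k (reverseInitial l hlk S) hS).toPlateQuotient =
      ∑ π ∈ orientedPartitions l S,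
        (-1 : ℂ) ^ ((k : ℤ) - (l : ℤ) - 1 - (π.len : ℤ)) • π.toPlateQuotient := by
  simp only [OrderedSetPartition.toPlateQuotient, ← map_smul, ← map_sum]
  rw [Submodule.mkQ_apply, Submodule.mkQ_apply, Submodule.Quotient.eq]
  refine Submodule.subset_span ⟨nongeneric n, measure_nongeneric n, fun x hx => ?_⟩
  simp only [Submodule.coe_sub, Submodule.coe_sum, Submodule.coe_smul, Pi.sub_apply,
    Finset.sum_apply, Pi.smul_apply, smul_eq_mul]
  exact sub_eq_zero.mpr (charFun_reverseInitial hl hlk hS hx)
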